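/- **Proposition 2.5.** Let $W$ be a Coxeter group with simple generating set $S$, length function $\ell$, identity $e$ and Bruhat order $\le$. For $J\subseteq S$ let $W_J$ be the subgroup generated by $J$ and let $W^J$ be the set of elements $w\in W$ that have minimal length in their coset $wW_J$. For $w\in W$ put $[e,w]=\{u\in W: u\le w\}$, $[e,w]^J=[e,w]\cap W^J$ and $P^J_w(t)=\sum_{x\in[e,w]^J}t^{\ell(x)}$. For $J\subseteq K\subseteq S$ put $W^J_K=W^J\cap W_K$. Let $J\subseteq K\subseteq S$ and $w\in W^J$. Lower Bruhat intervals are finite, so that the sums above are polynomials; $w$ has a unique parabolic decomposition $w=vu$ with respect to $K$, that is, $v\in W^K$, $u\in W_K$ and $\ell(w)=\ell(v)+\ell(u)$; and for every $x\in W^K$ with $x\le w$ the set $[e,w]^J\cap xW^J_K$ has a unique maximal element $q$ in Bruhat order, which is also its greatest element. Define $m^J_K(w,x):=x^{-1}q$. Then: 1. For every $x\in W^K$ with $x\le w$, the map $y\mapsto x^{-1}y$ is an isomorphism of graded posets $[e,w]^J\cap xW^J_K\simeq[e,m^J_K(w,x)]^J$. That is, with the induced Bruhat order both sets are graded, with length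 as rank function up to an additive constant, and the map is a bijection that preserves and reflects the order and satisfies $\ell(y)=\ell(x)+\ell(x^{-1}y)$. 2. $m^J_K(w,v)=u$. 3. If $x,\bar x\in W^K$ and $x<\bar x\le v$, then $m^J_K(w,x)\ge m^J_K(w,\bar x)$. 4. If $x\in W^K$ and $x\le v$, then $m^J_K(w,v)\le m^J_K(w,x)\le m^J_K(w,e)$. 5. $$P^J_w(t)=\sum_{x\in[e,w]^K}t^{\ell(x)}\cdot P^J_{m^J_K(w,x)}(t).$$ In particular, if $m^J_K(w,v)=m^J_K(w,e)$, then $P^J_w(t)=P^K_v(t)\cdot P^J_u(t)$. -/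

import Mathlib

open Polynomial

namespace CoxeterSystem

variable {B W : Type*} [Group W] {M : CoxeterMatrix B} (cs : CoxeterSystem M W)

/-- A single step of the Bruhat order: `w = u t` for a reflection `t`, and `ℓ(u) < ℓ(w)`. -/
def BruhatStep (u w : W) : Prop :=
  ∃ t : W, cs.IsReflection t ∧ w = u * t ∧ cs.length u < cs.length w

/-- The Bruhat order `u ≤ w`: the reflexive transitive closure of `BruhatStep`. -/
def BruhatLE (u w : W) : Prop := Relation.ReflTransGen cs.BruhatStep u w

/-- The strict Bruhat order `u < w`. -/
def BruhatLT (u w : W) : Prop := cs.BruhatLE u w ∧ u ≠ w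

/-- The standard parabolic subgroup `W_J`, generated by the simple reflections in `J`. -/
def parabolic (J : Set B) : Subgroup W := Subgroup.closure (cs.simple '' J)

/-- `W^J`: the elements `w` that have minimal length in their coset `w W_J`. -/
def minReps (J : Set B) : Set W :=
  {w | ∀ u ∈ cs.parabolic J, cs.length w ≤ cs.length (w * u)}

/-- `W^J_K = W^J ∩ W_K`. -/
def relMinReps (J K : Set B) : Set W := cs.minReps J ∩ (cs.parabolic K : Set W)

/-- The lower Bruhat interval `[e, w]`. -/
def lowerInterval (w : W) : Set W := {u | cs.BruhatLE u w}

/-- The relative lower Bruhat interval `[e, w]^J = [e, w] ∩ W^J`. -/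
def relInterval (J : Set B) (w : W) : Set W := cs.lowerInterval w ∩ cs.minReps J

/-- The set `[e, w]^J ∩ x W^J_K`. -/
def cosetInterval (J K : Set B) (w x : W) : Set W :=
  cs.relInterval J w ∩ (fun z => x * z) '' cs.relMinReps J K

/-- `q` is a maximal element of `A` with respect to the Bruhat order. -/
def IsMaximalIn (A : Set W) (q : W) : Prop :=
  q ∈ A ∧ ∀ y ∈ A, cs.BruhatLE q y → y = q

/-- `m^J_K(w, x) = x⁻¹ q`, where `q` is the maximal element of `[e, w]^J ∩ x W^J_K`. -/
noncomputable def maxShift (J K : Set B) (w x : W) : W :=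
  x⁻¹ * Classical.epsilon (fun q => cs.IsMaximalIn (cs.cosetInterval J K w x) q)

/-- `w = v u` is the parabolic decomposition of `w` with respect to `K`. -/
def IsParabolicDecomposition (K : Set B) (w v u : W) : Prop :=
  v ∈ cs.minReps K ∧ u ∈ cs.parabolic K ∧ w = v * u ∧
    cs.length w = cs.length v + cs.length u

/-- The set `A`, with the induced Bruhat order, is graded and the length is (up to a
shift) its rank function: length is strictly monotone on `A`, and it increases by
exactly one along every covering relation of the induced order. -/
def IsGradedByLength (A : Set W) : Prop :=
  (∀ y ∈ A, ∀ z ∈ A, cs.BruhatLT y z → cs.length y < cs.length z) ∧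
  (∀ y ∈ A, ∀ z ∈ A, cs.BruhatLT y z →
    (∀ a ∈ A, ¬ (cs.BruhatLT y a ∧ cs.BruhatLT a z)) →
    cs.length z = cs.length y + 1)

/-- The Poincaré polynomial `P^J_w(t) = ∑ t ^ ℓ(x)` over `x ∈ [e, w]^J`. -/
noncomputable def poincare (J : Set B) (w : W) : ℤ[X] :=
  ∑ᶠ x ∈ cs.relInterval J w, (X : ℤ[X]) ^ cs.length x

end CoxeterSystem

namespace CoxeterSystem

variable {B W : Type*} [Group W] {M : CoxeterMatrix B} (cs : CoxeterSystem M W)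

/-! ### The parity of inversions and the strong exchange property -/

/-! Every element factors uniquely as `x * a` with `x ∈ W^K` and `a ∈ W_K`, and lengths add, so `[e,
w]^J` splits into slices, one for each `x ∈ [e, w]^K`. Two facts describe a slice. Left
multiplication by `x` is an order embedding of `W_K` (`mul_bruhatLE_mul_iff`), and the part of `x
W_K` below `w` has a greatest element (`exists_greatest_coset`), whose projection to `W^J` is `q`.
Hence the slice is a translate of `[e, m]^J` with `m = x⁻¹ q`; summing over slices gives the formula
for the Poincaré polynomial. Gradedness comes from the chain property of `W^J`.

If `x ≤ x'` then `x m(w, x') ≤ x' m(w, x') ≤ w`, so `m(w, x')` competes in the slice of `x`; this is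
the antitonicity of the shift. When the two extreme shifts agree, all shifts equal `u`, and the sum
factors.

The Bruhat order is handled by the lifting property and induction along left descents. Lifting and
strong exchange both rest on the cocycle `inversionParity`, which detects right inversions without
reference to a word. -/

open Classical in
/-- The involution `(t, ε) ↦ (s t s, ε + [t = s])` of `W × ZMod 2` attached to a simple
reflection `s`. -/
noncomputable def signedConj (i : B) : Equiv.Perm (W × ZMod 2) :=
  Function.Involutive.toPerm
    (fun p => (cs.simple i * p.1 * cs.simple i, p.2 + if p.1 = cs.simple i then 1 else 0)) <| by
    rintro ⟨t, ε⟩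
    have h : cs.simple i * t * cs.simple i = cs.simple i ↔ t = cs.simple i := by
      constructor
      · intro h
        have h' := congrArg (fun z => z * cs.simple i) h
        simp only [simple_mul_simple_cancel_right, simple_mul_simple_self] at h'
        rw [← cs.inv_simple i]
        exact (inv_eq_of_mul_eq_one_right h').symm
      · rintro rfl
        simp
    simp only [h]
    refine Prod.ext ?_ ?_
    · simp [mul_assoc]
    · by_cases ht : t = cs.simple i
      · simp only [ht, if_true, add_assoc]
        rw [show (1 : ZMod 2) + 1 = 0 from rfl, add_zero]
      · simp [ht]

open Classical in
theorem signedConj_apply (i : B) (t : W) (ε : ZMod 2) :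
    cs.signedConj i (t, ε) =
      (cs.simple i * t * cs.simple i, ε + if t = cs.simple i then 1 else 0) := rfl

theorem simple_mul_pow_simple_mul_simple (i j : B) (k : ℕ) :
    cs.simple j * (cs.simple i * cs.simple j) ^ k =
      ((cs.simple i * cs.simple j)⁻¹) ^ k * cs.simple j := by
  have h : SemiconjBy (cs.simple j) (cs.simple i * cs.simple j) (cs.simple i * cs.simple j)⁻¹ := by
    simp [SemiconjBy, mul_assoc]
  exact h.pow_right k

-- The `2 * k` reflections in the sum form the right inversion sequence of the alternating word for
-- `(s_i s_j) ^ k`.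
open Classical in
theorem signedConj_mul_pow_apply (i j : B) (k : ℕ) (t : W) (ε : ZMod 2) :
    ((cs.signedConj i * cs.signedConj j) ^ k) (t, ε) =
      ((cs.simple i * cs.simple j) ^ k * t * ((cs.simple i * cs.simple j)⁻¹) ^ k,
        ε + ∑ n ∈ Finset.range (2 * k),
          if t = ((cs.simple i * cs.simple j)⁻¹) ^ n * cs.simple j then 1 else 0) := by
  induction k with
  | zero => simp
  | succ k ih =>
    have hc := cs.simple_mul_pow_simple_mul_simple i j k
    rw [pow_succ', Equiv.Perm.mul_apply, ih, Equiv.Perm.mul_apply, signedConj_apply,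
      signedConj_apply]
    set p := cs.simple i * cs.simple j with hp
    have h1 : p ^ k * t * p⁻¹ ^ k = cs.simple j ↔ t = p⁻¹ ^ (2 * k) * cs.simple j := by
      rw [two_mul, pow_add, mul_assoc (p⁻¹ ^ k), ← hc, inv_pow, mul_inv_eq_iff_eq_mul,
        eq_inv_mul_iff_mul_eq]
    have h2 : cs.simple j * (p ^ k * t * p⁻¹ ^ k) * cs.simple j = cs.simple i ↔
        t = p⁻¹ ^ (2 * k + 1) * cs.simple j := by
      have : p⁻¹ ^ (2 * k + 1) * cs.simple j
          = (p ^ k)⁻¹ * (cs.simple j * cs.simple i * cs.simple j) * p ^ k := by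
        rw [show 2 * k + 1 = k + (1 + k) by ring, pow_add, pow_add, mul_assoc, mul_assoc, ← hc,
          inv_pow, hp]
        simp [mul_assoc]
      rw [this, inv_pow]
      constructor
      · intro h
        rw [← h]
        simp [mul_assoc]
      · rintro rfl
        simp [mul_assoc]
    rw [if_congr h1 rfl rfl, if_congr h2 rfl rfl, show 2 * (k + 1) = 2 * k + 1 + 1 by ring,
      Finset.sum_range_succ, Finset.sum_range_succ]
    refine Prod.ext ?_ ?_
    · simp only [pow_succ' p, pow_succ p⁻¹]
      simp [hp, mul_assoc]
    · simp only [add_assoc]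

theorem signedConj_isLiftable : M.IsLiftable cs.signedConj := by
  classical
  intro i j
  ext1 ⟨t, ε⟩
  -- The sequence of reflections has period `M i j`, so both halves of the sum agree and cancel mod
  -- 2.
  rw [signedConj_mul_pow_apply, two_mul, Finset.sum_range_add]
  simp only [inv_pow, pow_add, simple_mul_simple_pow, mul_one, one_mul, inv_one,
    Equiv.Perm.coe_one, id_eq]
  rw [CharTwo.add_self_eq_zero, add_zero]

/-- The action of `W` on `W × ZMod 2` which extends `signedConj`. -/
noncomputable def signedConjHom : W →* Equiv.Perm (W × ZMod 2) :=
  cs.lift ⟨cs.signedConj, cs.signedConj_isLiftable⟩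

theorem signedConjHom_simple (i : B) : cs.signedConjHom (cs.simple i) = cs.signedConj i :=
  cs.lift_apply_simple cs.signedConj_isLiftable i

/-- The parity of the number of occurrences of `t` in the right inversion sequence of a word
for `w`; it equals `1` exactly if `t` is a right inversion of `w`. -/
noncomputable def inversionParity (w t : W) : ZMod 2 := (cs.signedConjHom w (t, 0)).2

theorem signedConjHom_apply (w t : W) (ε : ZMod 2) :
    cs.signedConjHom w (t, ε) = (w * t * w⁻¹, ε + cs.inversionParity w t) := by
  unfold inversionParity
  induction w using cs.simple_induction_left generalizing ε with
  | one => simp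
  | mul_simple_left w i ih =>
    rw [map_mul, Equiv.Perm.mul_apply, Equiv.Perm.mul_apply, ih ε, ih 0, signedConjHom_simple,
      signedConj_apply, signedConj_apply]
    simp [mul_assoc, add_assoc]

theorem inversionParity_mul (a b t : W) :
    cs.inversionParity (a * b) t =
      cs.inversionParity b t + cs.inversionParity a (b * t * b⁻¹) := by
  have h : cs.inversionParity (a * b) t = (cs.signedConjHom (a * b) (t, 0)).2 := rfl
  rw [h, map_mul, Equiv.Perm.mul_apply, signedConjHom_apply, signedConjHom_apply, zero_add]

theorem inversionParity_one (t : W) : cs.inversionParity 1 t = 0 := by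
  simp [inversionParity]

open Classical in
theorem inversionParity_simple (i : B) (t : W) :
    cs.inversionParity (cs.simple i) t = if t = cs.simple i then 1 else 0 := by
  simp [inversionParity, signedConjHom_simple, signedConj_apply]

/-- In `w s w⁻¹` the contributions of `w` and `w⁻¹` cancel by the cocycle identity for `w * w⁻¹ =
1`; only the middle letter counts. -/
theorem inversionParity_self {t : W} (ht : cs.IsReflection t) : cs.inversionParity t t = 1 := by
  obtain ⟨w, i, rfl⟩ := ht
  have h := cs.inversionParity_mul w w⁻¹ (w * cs.simple i * w⁻¹)
  rw [mul_inv_cancel, inversionParity_one] at h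
  rw [inversionParity_mul, inversionParity_mul, inversionParity_simple]
  simp only [inv_inv, mul_assoc, inv_mul_cancel_left, inv_mul_cancel, mul_one, one_mul, if_true,
    cs.inv_simple, simple_mul_simple_self] at h ⊢
  rw [add_left_comm, ← h, add_zero]

theorem mem_rightInvSeq_of_inversionParity {ω : List B} {t : W}
    (h : cs.inversionParity (cs.wordProd ω) t = 1) : t ∈ cs.rightInvSeq ω := by
  classical
  induction ω with
  | nil => simp [inversionParity_one] at h
  | cons i ω ih =>
    rw [wordProd_cons, inversionParity_mul, inversionParity_simple] at h
    rw [rightInvSeq, List.mem_cons]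
    by_cases ht : cs.wordProd ω * t * (cs.wordProd ω)⁻¹ = cs.simple i
    · left
      rw [← ht]
      simp [mul_assoc]
    · right
      rw [if_neg ht, add_zero] at h
      exact ih h

theorem length_mul_lt_of_inversionParity {w t : W} (h : cs.inversionParity w t = 1) :
    cs.length (w * t) < cs.length w := by
  obtain ⟨ω, hω, rfl⟩ := cs.exists_isReduced w
  exact (cs.isRightInversion_of_mem_rightInvSeq hω (cs.mem_rightInvSeq_of_inversionParity h)).2

/-- Multiplying by `t` flips the parity at `t`, so parity `0` for `w` means that `w * t` has parity
`1` and is the longer of the two. -/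
theorem inversionParity_eq_one_iff {w t : W} (ht : cs.IsReflection t) :
    cs.inversionParity w t = 1 ↔ cs.length (w * t) < cs.length w := by
  refine ⟨cs.length_mul_lt_of_inversionParity, fun h => ?_⟩
  by_contra hw
  have hw0 : cs.inversionParity w t = 0 := by
    generalize cs.inversionParity w t = z at hw
    revert hw; revert z; decide
  have h1 : cs.inversionParity (w * t) t = 1 := by
    rw [inversionParity_mul, inversionParity_self cs ht, mul_inv_cancel_right, hw0, add_zero]
  have h2 := cs.length_mul_lt_of_inversionParity h1
  rw [mul_assoc, ht.mul_self, mul_one] at h2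
  omega

theorem inversionParity_eq_zero_iff {w t : W} (ht : cs.IsReflection t) :
    cs.inversionParity w t = 0 ↔ cs.length w < cs.length (w * t) := by
  have h1 := cs.inversionParity_eq_one_iff (w := w) ht
  have h2 := ht.length_mul_left_ne w
  have h3 : cs.inversionParity w t = 0 ↔ ¬ cs.inversionParity w t = 1 := by
    generalize cs.inversionParity w t = z
    revert z; decide
  rw [h3, h1]
  omega

/-- The strong exchange property. -/
theorem exists_mul_eq_wordProd_eraseIdx {ω : List B} {t : W} (ht : cs.IsReflection t)
    (h : cs.length (cs.wordProd ω * t) < cs.length (cs.wordProd ω)) :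
    ∃ j < ω.length, cs.wordProd ω * t = cs.wordProd (ω.eraseIdx j) := by
  have hmem := cs.mem_rightInvSeq_of_inversionParity ((cs.inversionParity_eq_one_iff ht).2 h)
  obtain ⟨j, hj, rfl⟩ := List.mem_iff_getElem.1 hmem
  rw [length_rightInvSeq] at hj
  refine ⟨j, hj, ?_⟩
  rw [← wordProd_mul_getD_rightInvSeq, List.getD_eq_getElem]

/-! ### The Bruhat order and the lifting property -/

variable {cs}

theorem BruhatStep.length_lt {u w : W} (h : cs.BruhatStep u w) : cs.length u < cs.length w := by
  obtain ⟨t, -, -, h⟩ := h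
  exact h

theorem BruhatLE.refl (u : W) : cs.BruhatLE u u := Relation.ReflTransGen.refl

theorem BruhatLE.trans {u v w : W} (h : cs.BruhatLE u v) (h' : cs.BruhatLE v w) :
    cs.BruhatLE u w := Relation.ReflTransGen.trans h h'

theorem BruhatLE.eq_or_length_lt {u w : W} (h : cs.BruhatLE u w) :
    u = w ∨ cs.length u < cs.length w := by
  induction h with
  | refl => exact Or.inl rfl
  | tail _ h ih =>
    right
    rcases ih with rfl | ih
    · exact h.length_lt
    · exact ih.trans h.length_lt

theorem BruhatLE.length_le {u w : W} (h : cs.BruhatLE u w) : cs.length u ≤ cs.length w := by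
  rcases h.eq_or_length_lt with rfl | h
  · exact le_rfl
  · exact h.le

theorem BruhatLT.length_lt {u w : W} (h : cs.BruhatLT u w) : cs.length u < cs.length w :=
  h.1.eq_or_length_lt.resolve_left h.2

theorem BruhatLE.antisymm {u w : W} (h : cs.BruhatLE u w) (h' : cs.BruhatLE w u) : u = w :=
  h.eq_or_length_lt.resolve_right h'.length_le.not_gt

theorem BruhatStep.inv {u w : W} (h : cs.BruhatStep u w) : cs.BruhatStep u⁻¹ w⁻¹ := by
  obtain ⟨t, ht, rfl, hl⟩ := h
  refine ⟨u * t * u⁻¹, ht.conj u, ?_, by rwa [length_inv, length_inv]⟩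
  simp [mul_assoc, ht.inv]

theorem BruhatLE.inv {u w : W} (h : cs.BruhatLE u w) : cs.BruhatLE u⁻¹ w⁻¹ := by
  induction h with
  | refl => exact BruhatLE.refl _
  | tail _ h ih => exact Relation.ReflTransGen.tail ih h.inv

variable (cs)

theorem bruhatLE_mul_simple {w : W} {i : B} (h : cs.length w ≤ cs.length (w * cs.simple i)) :
    cs.BruhatLE w (w * cs.simple i) :=
  Relation.ReflTransGen.single ⟨cs.simple i, cs.isReflection_simple i, rfl,
    lt_of_le_of_ne h (cs.length_mul_simple_ne w i).symm⟩

theorem bruhatLE_simple_mul {w : W} {i : B} (h : cs.length w ≤ cs.length (cs.simple i * w)) :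
    cs.BruhatLE w (cs.simple i * w) := by
  have h' := cs.bruhatLE_mul_simple (w := w⁻¹) (i := i) (by
    rw [length_inv, ← length_inv cs (_ * _)]; simpa using h)
  simpa using h'.inv

theorem simple_mul_bruhatLE {w : W} {i : B} (h : cs.length (cs.simple i * w) ≤ cs.length w) :
    cs.BruhatLE (cs.simple i * w) w := by
  simpa using cs.bruhatLE_simple_mul (w := cs.simple i * w) (i := i) (by simpa using h)

variable {cs}

/-- By the cocycle identity, left multiplication by `s` changes the parity of `u` at `t` only when
`u t u⁻¹ = s`. This is the source of all lifting properties below. -/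
theorem BruhatStep.simple_mul {u w : W} (h : cs.BruhatStep u w) (i : B) :
    cs.simple i * u = w ∨ cs.BruhatStep (cs.simple i * u) (cs.simple i * w) := by
  classical
  obtain ⟨t, ht, rfl, hl⟩ := h
  by_cases hs : u * t * u⁻¹ = cs.simple i
  · left
    rw [← hs]
    simp
  · right
    refine ⟨t, ht, (mul_assoc _ _ _).symm, ?_⟩
    rw [← mul_assoc, ← inversionParity_eq_zero_iff cs ht, inversionParity_mul,
      inversionParity_simple, if_neg hs, add_zero, inversionParity_eq_zero_iff cs ht]
    exact hl

theorem BruhatLE.simple_mul_le_or {u w : W} (h : cs.BruhatLE u w) (i : B) :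
    cs.BruhatLE (cs.simple i * u) w ∨ cs.BruhatLE (cs.simple i * u) (cs.simple i * w) := by
  induction h with
  | refl => exact Or.inr (BruhatLE.refl _)
  | tail _ h ih =>
    rcases ih with ih | ih
    · exact Or.inl (Relation.ReflTransGen.tail ih h)
    · rcases h.simple_mul i with rfl | h
      · exact Or.inl ih
      · exact Or.inr (Relation.ReflTransGen.tail ih h)

theorem BruhatLE.le_simple_mul_or {u w : W} (h : cs.BruhatLE u w) (i : B) :
    cs.BruhatLE u (cs.simple i * w) ∨ cs.BruhatLE (cs.simple i * u) (cs.simple i * w) := by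
  induction h with
  | refl => exact Or.inr (BruhatLE.refl _)
  | tail hu h ih =>
    rcases h.simple_mul i with rfl | h
    · left
      rw [simple_mul_simple_cancel_left]
      exact hu
    · exact ih.imp (fun ih => Relation.ReflTransGen.tail ih h)
        (fun ih => Relation.ReflTransGen.tail ih h)

theorem BruhatLE.mul_simple_le_or {u w : W} (h : cs.BruhatLE u w) (i : B) :
    cs.BruhatLE (u * cs.simple i) w ∨ cs.BruhatLE (u * cs.simple i) (w * cs.simple i) :=
  (h.inv.simple_mul_le_or i).imp (fun h => by simpa using h.inv) (fun h => by simpa using h.inv)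

theorem BruhatLE.le_mul_simple_or {u w : W} (h : cs.BruhatLE u w) (i : B) :
    cs.BruhatLE u (w * cs.simple i) ∨ cs.BruhatLE (u * cs.simple i) (w * cs.simple i) :=
  (h.inv.le_simple_mul_or i).imp (fun h => by simpa using h.inv) (fun h => by simpa using h.inv)

/-- The lifting property: multiplying both sides by a simple reflection which lowers `u`. -/
theorem BruhatLE.simple_mul_le_simple_mul {u w : W} {i : B} (h : cs.BruhatLE u w)
    (hu : cs.length (cs.simple i * u) ≤ cs.length u) :
    cs.BruhatLE (cs.simple i * u) (cs.simple i * w) :=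
  (h.le_simple_mul_or i).elim (cs.simple_mul_bruhatLE hu).trans id

/-- The lifting property: multiplying both sides by a simple reflection which raises `w`. -/
theorem BruhatLE.simple_mul_le_simple_mul_of_le {u w : W} {i : B} (h : cs.BruhatLE u w)
    (hw : cs.length w ≤ cs.length (cs.simple i * w)) :
    cs.BruhatLE (cs.simple i * u) (cs.simple i * w) :=
  (h.simple_mul_le_or i).elim (fun h => h.trans (cs.bruhatLE_simple_mul hw)) id

theorem BruhatLE.le_simple_mul {u w : W} {i : B} (h : cs.BruhatLE u w)
    (hu : cs.length u ≤ cs.length (cs.simple i * u)) :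
    cs.BruhatLE u (cs.simple i * w) :=
  (h.le_simple_mul_or i).elim id (cs.bruhatLE_simple_mul hu).trans

theorem BruhatLE.simple_mul_le {u w : W} {i : B} (h : cs.BruhatLE u w)
    (hw : cs.length (cs.simple i * w) ≤ cs.length w) :
    cs.BruhatLE (cs.simple i * u) w :=
  (h.simple_mul_le_or i).elim id (fun h => h.trans (cs.simple_mul_bruhatLE hw))

theorem BruhatLE.le_mul_simple {u w : W} {i : B} (h : cs.BruhatLE u w)
    (hu : cs.length u ≤ cs.length (u * cs.simple i)) :
    cs.BruhatLE u (w * cs.simple i) :=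
  (h.le_mul_simple_or i).elim id (cs.bruhatLE_mul_simple hu).trans

theorem BruhatLE.mul_simple_le_mul_simple {u w : W} {i : B} (h : cs.BruhatLE u w)
    (hw : cs.length w ≤ cs.length (w * cs.simple i)) :
    cs.BruhatLE (u * cs.simple i) (w * cs.simple i) :=
  (h.mul_simple_le_or i).elim (fun h => h.trans (cs.bruhatLE_mul_simple hw)) id

variable (cs)

theorem exists_simple_mul_length {w : W} (hw : w ≠ 1) :
    ∃ i, cs.length (cs.simple i * w) + 1 = cs.length w := by
  obtain ⟨i, hi⟩ := cs.exists_leftDescent_of_ne_one hw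
  exact ⟨i, cs.isLeftDescent_iff.1 hi⟩

/-- Induction on the length, peeling off left descents. -/
theorem leftDescent_induction {p : W → Prop} (one : p 1)
    (step : ∀ w i, cs.length (cs.simple i * w) + 1 = cs.length w → p (cs.simple i * w) → p w)
    (w : W) : p w := by
  induction hn : cs.length w generalizing w with
  | zero =>
    rw [length_eq_zero_iff] at hn
    exact hn ▸ one
  | succ n ih =>
    have hw : w ≠ 1 := by
      rintro rfl
      simp at hn
    obtain ⟨i, hi⟩ := cs.exists_simple_mul_length hw
    exact step w i hi (ih _ (by omega))

theorem one_bruhatLE (w : W) : cs.BruhatLE 1 w := by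
  induction w using cs.leftDescent_induction with
  | one => exact BruhatLE.refl _
  | step w i hi ih => exact ih.trans (cs.simple_mul_bruhatLE (by omega))

theorem lowerInterval_finite (w : W) : (cs.lowerInterval w).Finite := by
  induction w using cs.leftDescent_induction with
  | one =>
    refine (Set.finite_singleton (1 : W)).subset fun y hy => ?_
    exact BruhatLE.antisymm hy (cs.one_bruhatLE y)
  | step w i hi ih =>
    -- By lifting, `[e, w]` lies in the union of `[e, s w]` and its translate by `s`.
    refine (ih.union (ih.image (fun y => cs.simple i * y))).subset fun y hy => ?_
    rcases BruhatLE.le_simple_mul_or hy i with h | h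
    · exact Or.inl h
    · exact Or.inr ⟨_, h, by simp⟩

/-! ### Parabolic subgroups and minimal coset representatives -/

variable {cs} {J K : Set B}

theorem parabolic_mono (h : J ⊆ K) : cs.parabolic J ≤ cs.parabolic K :=
  Subgroup.closure_mono (Set.image_mono h)

variable (cs)

theorem simple_mem_parabolic {i : B} (hi : i ∈ K) : cs.simple i ∈ cs.parabolic K :=
  Subgroup.subset_closure ⟨i, hi, rfl⟩

theorem wordProd_mem_parabolic {ω : List B} (h : ∀ i ∈ ω, i ∈ K) :
    cs.wordProd ω ∈ cs.parabolic K := by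
  induction ω with
  | nil => simp [one_mem]
  | cons i ω ih =>
    rw [wordProd_cons]
    exact mul_mem (cs.simple_mem_parabolic (h i (by simp))) (ih fun j hj => h j (by simp [hj]))

variable {cs}

theorem exists_isReduced_of_mem_parabolic {a : W} (ha : a ∈ cs.parabolic K) :
    ∃ ω : List B, cs.IsReduced ω ∧ cs.wordProd ω = a ∧ ∀ i ∈ ω, i ∈ K := by
  have key : ∀ a : W, ∀ i ∈ K,
      (∃ ω : List B, cs.IsReduced ω ∧ cs.wordProd ω = a ∧ ∀ j ∈ ω, j ∈ K) →
      ∃ ω : List B, cs.IsReduced ω ∧ cs.wordProd ω = a * cs.simple i ∧ ∀ j ∈ ω, j ∈ K := by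
    rintro _ i hi ⟨ω, hω, rfl, hK⟩
    rcases cs.length_mul_simple (cs.wordProd ω) i with h | h
    · refine ⟨ω ++ [i], ?_, by simp [wordProd_append], ?_⟩
      · rw [IsReduced, wordProd_append, wordProd_singleton, h, hω.eq]
        simp
      · intro j hj
        rcases List.mem_append.1 hj with hj | hj
        · exact hK j hj
        · rw [List.mem_singleton.1 hj]
          exact hi
    -- Exchange deletes a letter, so the word stays in `K`.
    · obtain ⟨j, hj, he⟩ :=
        cs.exists_mul_eq_wordProd_eraseIdx (cs.isReflection_simple i)
          (show cs.length (cs.wordProd ω * cs.simple i) < cs.length (cs.wordProd ω) by omega)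
      refine ⟨ω.eraseIdx j, ?_, he.symm, fun k hk => hK k (List.mem_of_mem_eraseIdx hk)⟩
      rw [IsReduced, ← he, List.length_eraseIdx_of_lt hj]
      have := hω.eq
      omega
  induction ha using Subgroup.closure_induction_right with
  | one => exact ⟨[], by simp [IsReduced], by simp, by simp⟩
  | mul_right a _ y hy ih =>
    obtain ⟨i, hi, rfl⟩ := hy
    exact key a i hi ih
  | mul_inv_cancel a _ y hy ih =>
    obtain ⟨i, hi, rfl⟩ := hy
    rw [inv_simple]
    exact key a i hi ih

/-- Induction on the length of the elements of a parabolic subgroup, peeling off right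
descents. -/
@[elab_as_elim]
theorem parabolic_induction {p : (a : W) → a ∈ cs.parabolic K → Prop} (one : p 1 (one_mem _))
    (step : ∀ (a : W) (ha : a ∈ cs.parabolic K) (i : B) (hi : i ∈ K),
      cs.length (a * cs.simple i) = cs.length a + 1 → p a ha →
      p (a * cs.simple i) (mul_mem ha (cs.simple_mem_parabolic hi)))
    {a : W} (ha : a ∈ cs.parabolic K) : p a ha := by
  obtain ⟨ω, hω, rfl, hK⟩ := exists_isReduced_of_mem_parabolic ha
  induction ω using List.reverseRecOn with
  | nil => simpa using one
  | append_singleton ω i ih =>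
    have hred : cs.IsReduced ω := by simpa using hω.take ω.length
    have hω' : ∀ j ∈ ω, j ∈ K := fun j hj => hK j (by simp [hj])
    simp only [wordProd_append, wordProd_singleton]
    refine step _ (cs.wordProd_mem_parabolic hω') i (hK i (by simp)) ?_
      (ih hred hω' (cs.wordProd_mem_parabolic hω'))
    have h1 := hω.eq
    rw [wordProd_append, wordProd_singleton] at h1
    rw [h1, hred.eq, List.length_append, List.length_singleton]

theorem BruhatLE.mem_parabolic {a b : W} (h : cs.BruhatLE a b) (hb : b ∈ cs.parabolic K) :
    a ∈ cs.parabolic K := by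
  induction h using Relation.ReflTransGen.head_induction_on with
  | refl => exact hb
  | head h _ ih =>
    obtain ⟨t, ht, rfl, hl⟩ := h
    obtain ⟨ω, -, he, hK⟩ := exists_isReduced_of_mem_parabolic ih
    rename_i a _
    have ha : a = cs.wordProd ω * t := by rw [he, mul_assoc, ht.mul_self, mul_one]
    obtain ⟨j, -, hj⟩ := cs.exists_mul_eq_wordProd_eraseIdx ht (ω := ω) (by rwa [← ha, he])
    rw [ha, hj]
    exact cs.wordProd_mem_parabolic fun k hk => hK k (List.mem_of_mem_eraseIdx hk)

theorem length_mul_of_mem_minReps {x a : W} (hx : x ∈ cs.minReps K) (ha : a ∈ cs.parabolic K) :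
    cs.length (x * a) = cs.length x + cs.length a := by
  induction ha using parabolic_induction with
  | one => simp
  | step a ha i hi hl ih =>
    rcases cs.length_mul_simple (x * a) i with h | h
    · rw [← mul_assoc, h, ih, hl, add_assoc]
    · exfalso
      have hr := cs.isReflection_simple i
      have h1 := (cs.inversionParity_eq_one_iff hr (w := x * a)).2 (by omega)
      have h0 := (cs.inversionParity_eq_zero_iff hr (w := a)).2 (by omega)
      -- The descent must come from `x`: it makes `a s a⁻¹ ∈ W_K` a right inversion of `x`, against
      -- minimality.
      rw [inversionParity_mul, h0, zero_add] at h1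
      have h2 := cs.length_mul_lt_of_inversionParity h1
      exact h2.not_ge (hx _ (mul_mem (mul_mem ha (cs.simple_mem_parabolic hi)) (inv_mem ha)))

theorem mul_mem_minReps_iff (hJK : J ⊆ K) {x a : W} (hx : x ∈ cs.minReps K)
    (ha : a ∈ cs.parabolic K) : x * a ∈ cs.minReps J ↔ a ∈ cs.minReps J := by
  refine forall₂_congr fun u hu => ?_
  rw [mul_assoc, length_mul_of_mem_minReps hx ha,
    length_mul_of_mem_minReps hx (mul_mem ha (parabolic_mono hJK hu)), add_le_add_iff_left]

theorem one_mem_minReps : (1 : W) ∈ cs.minReps K := fun u _ => by simp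

variable (cs K) in
theorem exists_mul_eq_minReps (w : W) :
    ∃ x ∈ cs.minReps K, ∃ a ∈ cs.parabolic K, w = x * a := by
  induction hn : cs.length w using Nat.strong_induction_on generalizing w with
  | _ n ih =>
    by_cases hw : w ∈ cs.minReps K
    · exact ⟨w, hw, 1, one_mem _, (mul_one w).symm⟩
    · simp only [minReps, Set.mem_ofPred_eq, not_forall, not_le] at hw
      obtain ⟨u, hu, hlt⟩ := hw
      obtain ⟨x, hx, a, ha, he⟩ := ih _ (hn ▸ hlt) (w * u) rfl
      exact ⟨x, hx, a * u⁻¹, mul_mem ha (inv_mem hu), by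
        rw [← mul_assoc, ← he, mul_inv_cancel_right]⟩

theorem eq_of_mul_eq_mul_minReps {x x' a a' : W} (hx : x ∈ cs.minReps K) (hx' : x' ∈ cs.minReps K)
    (ha : a ∈ cs.parabolic K) (ha' : a' ∈ cs.parabolic K) (h : x * a = x' * a') :
    x = x' ∧ a = a' := by
  have h1 : x' = x * (a * a'⁻¹) := by rw [← mul_assoc, h, mul_inv_cancel_right]
  have h2 : x = x' * (a' * a⁻¹) := by rw [← mul_assoc, ← h, mul_inv_cancel_right]
  have hb := mul_mem ha (inv_mem ha')
  have l1 := length_mul_of_mem_minReps hx hb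
  have l2 := length_mul_of_mem_minReps hx' (mul_mem ha' (inv_mem ha))
  rw [← h1] at l1
  rw [← h2] at l2
  have h0 : a * a'⁻¹ = 1 := by
    rw [← cs.length_eq_zero_iff]
    omega
  rw [h0, mul_one] at h1
  exact ⟨h1.symm, by rwa [mul_inv_eq_one] at h0⟩

variable (cs K) in
theorem existsUnique_isParabolicDecomposition (w : W) :
    ∃! p : W × W, cs.IsParabolicDecomposition K w p.1 p.2 := by
  obtain ⟨x, hx, a, ha, rfl⟩ := cs.exists_mul_eq_minReps K w
  refine ⟨(x, a), ⟨hx, ha, rfl, length_mul_of_mem_minReps hx ha⟩, ?_⟩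
  rintro ⟨y, b⟩ ⟨hy, hb, he, -⟩
  obtain ⟨rfl, rfl⟩ := eq_of_mul_eq_mul_minReps hx hy ha hb he
  rfl

/-! ### Bruhat order on parabolic cosets -/

theorem bruhatLE_mul_of_mem_minReps {x a : W} (hx : x ∈ cs.minReps K) (ha : a ∈ cs.parabolic K) :
    cs.BruhatLE x (x * a) := by
  induction ha using parabolic_induction with
  | one => simpa using BruhatLE.refl x
  | step a ha i hi hl ih =>
    have h1 := length_mul_of_mem_minReps hx ha
    have h2 := length_mul_of_mem_minReps hx (mul_mem ha (cs.simple_mem_parabolic hi))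
    rw [← mul_assoc] at h2 ⊢
    exact ih.trans (cs.bruhatLE_mul_simple (by omega))

/-- The projection `W → W^K` preserves the Bruhat order: if `y ∈ W^K` lies below `x a`, then it
lies below `x`. -/
theorem BruhatLE.le_of_le_mul {x a y : W} (hy : y ∈ cs.minReps K) (ha : a ∈ cs.parabolic K)
    (h : cs.BruhatLE y (x * a)) : cs.BruhatLE y x := by
  induction ha using parabolic_induction with
  | one => simpa using h
  | step a ha i hi hl ih =>
    have := h.le_mul_simple (i := i) (hy _ (cs.simple_mem_parabolic hi))
    exact ih (by simpa [mul_assoc] using this)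

theorem mul_bruhatLE_mul_of_mem_minReps {x x' a : W} (hx' : x' ∈ cs.minReps K)
    (ha : a ∈ cs.parabolic K) (h : cs.BruhatLE x x') : cs.BruhatLE (x * a) (x' * a) := by
  induction ha using parabolic_induction with
  | one => simpa using h
  | step a ha i hi hl ih =>
    have h1 := length_mul_of_mem_minReps hx' ha
    have h2 := length_mul_of_mem_minReps hx' (mul_mem ha (cs.simple_mem_parabolic hi))
    rw [← mul_assoc] at h2
    rw [← mul_assoc, ← mul_assoc]
    exact ih.mul_simple_le_mul_simple (by omega)

theorem simple_mul_mem_minReps {x : W} {i : B} (hx : x ∈ cs.minReps K)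
    (hi : cs.length (cs.simple i * x) + 1 = cs.length x) : cs.simple i * x ∈ cs.minReps K := by
  intro u hu
  have h1 := hx u hu
  rw [mul_assoc]
  rcases cs.length_simple_mul (x * u) i with h | h <;> omega

/-- Deodhar's lemma. -/
theorem simple_mul_mem_minReps_or {x : W} (hx : x ∈ cs.minReps K) (i : B) :
    cs.simple i * x ∈ cs.minReps K ∨ ∃ r ∈ cs.parabolic K, cs.simple i * x = x * r := by
  classical
  by_cases h : cs.simple i * x ∈ cs.minReps K
  · exact Or.inl h
  right
  have hi : cs.length (cs.simple i * x) = cs.length x + 1 :=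
    (cs.length_simple_mul x i).resolve_right fun hi => h (simple_mul_mem_minReps hx hi)
  simp only [minReps, Set.mem_ofPred_eq, not_forall, not_le] at h
  obtain ⟨u, hu, hlt⟩ := h
  have hxu := length_mul_of_mem_minReps hx hu
  -- `ℓ(x) + ℓ(u) - 1 ≤ ℓ(s x u) < ℓ(x) + 1` leaves only length one.
  have hlt' : cs.length u = 1 := by
    have hne : cs.length u ≠ 0 := by
      rw [Ne, length_eq_zero_iff]
      rintro rfl
      simp at hlt
    rw [mul_assoc] at hlt
    rcases cs.length_simple_mul (x * u) i with h | h <;> omega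
  obtain ⟨j, rfl⟩ := cs.length_eq_one_iff.1 hlt'
  refine ⟨_, hu, ?_⟩
  have hr := cs.isReflection_simple j
  have h1 := (cs.inversionParity_eq_one_iff hr).2 hlt
  have h0 := (cs.inversionParity_eq_zero_iff hr (w := x)).2 (by omega)
  rw [inversionParity_mul, h0, zero_add, inversionParity_simple] at h1
  have h2 : x * cs.simple j * x⁻¹ = cs.simple i := by
    by_contra hne
    simp [hne] at h1
  rw [← h2, inv_mul_cancel_right]

/-- Left multiplication by `x ∈ W^K` is an order embedding of `W_K`. -/
theorem mul_bruhatLE_mul_iff {x a b : W} (hx : x ∈ cs.minReps K) (ha : a ∈ cs.parabolic K)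
    (hb : b ∈ cs.parabolic K) : cs.BruhatLE (x * a) (x * b) ↔ cs.BruhatLE a b := by
  induction x using cs.leftDescent_induction with
  | one => simp
  | step x i hi ih =>
    have hx' := simple_mul_mem_minReps hx hi
    rw [← ih hx']
    -- Since lengths add, the descent `s` of `x` is a descent of both `x a` and `x b`, so lifting
    -- applies in both directions.
    have hla := length_mul_of_mem_minReps hx ha
    have hlb := length_mul_of_mem_minReps hx hb
    have hla' := length_mul_of_mem_minReps hx' ha
    have hlb' := length_mul_of_mem_minReps hx' hb
    rw [mul_assoc] at hla' hlb'
    rw [mul_assoc, mul_assoc]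
    constructor
    · intro h
      exact h.simple_mul_le_simple_mul (by omega)
    · intro h
      have := h.simple_mul_le_simple_mul_of_le (i := i)
        (by rw [simple_mul_simple_cancel_left]; omega)
      simpa using this

/-- The chain property of `W^J`. -/
theorem exists_bruhatLT_length_add_one {y z : W} (hy : y ∈ cs.minReps J) (hz : z ∈ cs.minReps J)
    (h : cs.BruhatLT y z) :
    ∃ a ∈ cs.minReps J, cs.BruhatLE y a ∧ cs.BruhatLT a z ∧ cs.length z = cs.length a + 1 := by
  induction z using cs.leftDescent_induction generalizing y with
  | one => exact absurd h.length_lt (by simp)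
  | step z i hi ih =>
    have hz' := simple_mul_mem_minReps hz hi
    have hsz : cs.BruhatLT (cs.simple i * z) z :=
      ⟨cs.simple_mul_bruhatLE (by omega), fun he => cs.length_simple_mul_ne z i (by rw [he])⟩
    by_cases hle : cs.BruhatLE y (cs.simple i * z)
    · exact ⟨_, hz', hle, hsz, hi.symm⟩
    -- If `s` raised `y`, lifting would put `y` below `s z`. So `s` lowers both, and induction gives
    -- `a` between `s y` and `s z`; the candidate is `s a`.
    have hyi : cs.length (cs.simple i * y) + 1 = cs.length y :=
      (cs.length_simple_mul y i).resolve_left fun hyi => hle (h.1.le_simple_mul (by omega))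
    have hlt : cs.BruhatLT (cs.simple i * y) (cs.simple i * z) :=
      ⟨h.1.simple_mul_le_simple_mul (by omega), fun he => h.2 (mul_left_cancel he)⟩
    obtain ⟨a, ha, hya, haz, hl⟩ := ih (simple_mul_mem_minReps hy hyi) hz' hlt
    rcases cs.length_simple_mul a i with hai | hai
    · have hya' : cs.BruhatLE y (cs.simple i * a) := by
        simpa using hya.simple_mul_le_simple_mul_of_le (i := i) (by omega)
      rcases simple_mul_mem_minReps_or ha i with hmem | ⟨r, hr, he⟩
      · refine ⟨_, hmem, hya', ⟨?_, fun he => ?_⟩, by omega⟩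
        · simpa using haz.1.simple_mul_le_simple_mul_of_le (i := i) (by simp; omega)
        · have := congrArg cs.length he
          omega
      -- If `s a` leaves `W^J`, it lies in `a W_J`, and projecting `y ≤ s a` gives `y ≤ a ≤ s z`,
      -- which is excluded.
      · rw [he] at hya'
        exact absurd ((hya'.le_of_le_mul hy hr).trans haz.1) hle
    · have := hya.simple_mul_le (i := i) (by omega)
      rw [simple_mul_simple_cancel_left] at this
      exact absurd (this.trans haz.1) hle

/-! ### Lower intervals and cosets -/

/-- The intersection of a lower interval with a coset of a parabolic subgroup has a greatest
element. -/
theorem exists_greatest_coset {x w : W} (hx : x ∈ cs.minReps K) (hxw : cs.BruhatLE x w) :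
    ∃ b ∈ cs.parabolic K, cs.BruhatLE (x * b) w ∧
      ∀ a ∈ cs.parabolic K, cs.BruhatLE (x * a) w → cs.BruhatLE (x * a) (x * b) := by
  induction w using cs.leftDescent_induction generalizing x with
  | one =>
    have : x = 1 := hxw.antisymm (cs.one_bruhatLE x)
    subst this
    refine ⟨1, one_mem _, by simpa using BruhatLE.refl _, fun a _ ha => by simpa using ha⟩
  | step w i hi ih =>
    have hw : cs.BruhatLE (cs.simple i * w) w := cs.simple_mul_bruhatLE (by omega)
    rcases cs.length_simple_mul x i with hxi | hxi
    · obtain ⟨b, hb, hbw, hmax⟩ := ih hx (hxw.le_simple_mul (by omega))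
      rcases simple_mul_mem_minReps_or hx i with hmem | ⟨r, hr, he⟩
      -- Here `s` raises the whole coset, so its elements below `w` are already below `s w`.
      · refine ⟨b, hb, hbw.trans hw, fun a ha h => hmax a ha (h.le_simple_mul ?_)⟩
        have h1 := length_mul_of_mem_minReps hx ha
        have h2 := length_mul_of_mem_minReps hmem ha
        rw [mul_assoc] at h2
        omega
      -- Here `s` maps the coset to itself; the greatest element is the larger of `x b` and `s x b`.
      · have hsb : ∀ c, cs.simple i * (x * c) = x * (r * c) := fun c => by
          rw [← mul_assoc, he, mul_assoc]
        have hle : ∀ a ∈ cs.parabolic K, cs.BruhatLE (x * a) w →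
            cs.BruhatLE (x * a) (x * b) ∨ cs.BruhatLE (x * a) (x * (r * b)) := by
          intro a ha h
          rcases h.le_simple_mul_or i with h | h
          · exact Or.inl (hmax a ha h)
          · rw [hsb] at h
            have h' := (hmax _ (mul_mem hr ha) h).simple_mul_le_or i
            rwa [← hsb, simple_mul_simple_cancel_left, hsb] at h'
        have hbw' : cs.BruhatLE (x * (r * b)) w := by
          rw [← hsb]
          exact (hbw.trans hw).simple_mul_le (by omega)
        rcases cs.length_simple_mul (x * b) i with hbi | hbi
        · have hb' : cs.BruhatLE (x * b) (x * (r * b)) := by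
            rw [← hsb]
            exact cs.bruhatLE_simple_mul (by omega)
          exact ⟨r * b, mul_mem hr hb, hbw',
            fun a ha h => (hle a ha h).elim (fun h => h.trans hb') id⟩
        · have hb' : cs.BruhatLE (x * (r * b)) (x * b) := by
            rw [← hsb]
            exact cs.simple_mul_bruhatLE (by omega)
          exact ⟨b, hb, hbw.trans hw, fun a ha h => (hle a ha h).elim id fun h => h.trans hb'⟩
    -- Here `s` lowers the whole coset, and the problem moves to `s x` and `s w`.
    · have hx' := simple_mul_mem_minReps hx hxi
      have hlen : ∀ a ∈ cs.parabolic K,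
          cs.length (cs.simple i * (x * a)) + 1 = cs.length (x * a) := fun a ha => by
        have h1 := length_mul_of_mem_minReps hx ha
        have h2 := length_mul_of_mem_minReps hx' ha
        rw [mul_assoc] at h2
        omega
      obtain ⟨b, hb, hbw, hmax⟩ := ih hx' (hxw.simple_mul_le_simple_mul (by omega))
      rw [mul_assoc] at hbw
      have hb1 := hlen b hb
      refine ⟨b, hb, ?_, fun a ha h => ?_⟩
      · simpa using hbw.simple_mul_le_simple_mul_of_le (i := i) (by simp; omega)
      · have ha1 := hlen a ha
        have h1 := h.simple_mul_le_simple_mul (i := i) (by omega)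
        rw [← mul_assoc] at h1
        have h2 := hmax a ha h1
        rw [mul_assoc, mul_assoc] at h2
        simpa using h2.simple_mul_le_simple_mul_of_le (i := i) (by simp; omega)

theorem mul_mem_cosetInterval_iff (hJK : J ⊆ K) {w x a : W} (hx : x ∈ cs.minReps K) :
    x * a ∈ cs.cosetInterval J K w x ↔
      a ∈ cs.parabolic K ∧ a ∈ cs.minReps J ∧ cs.BruhatLE (x * a) w := by
  constructor
  · rintro ⟨⟨h, -⟩, b, ⟨hb, hbK⟩, he⟩
    obtain rfl : b = a := mul_left_cancel he
    exact ⟨hbK, hb, h⟩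
  · rintro ⟨haK, ha, h⟩
    exact ⟨⟨h, (mul_mem_minReps_iff hJK hx haK).2 ha⟩, a, ⟨ha, haK⟩, rfl⟩

theorem exists_of_mem_cosetInterval {w x y : W} (hy : y ∈ cs.cosetInterval J K w x) :
    ∃ a, y = x * a := by
  obtain ⟨-, a, -, rfl⟩ := hy
  exact ⟨a, rfl⟩

theorem exists_greatest_cosetInterval (hJK : J ⊆ K) {x w : W} (hx : x ∈ cs.minReps K)
    (hxw : cs.BruhatLE x w) :
    ∃ q ∈ cs.cosetInterval J K w x, ∀ y ∈ cs.cosetInterval J K w x, cs.BruhatLE y q := by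
  obtain ⟨b, hb, hbw, hmax⟩ := exists_greatest_coset hx hxw
  -- Dropping the `W_J`-part `d` of `b` loses nothing: elements of `W^J` below `x c d` lie below `x
  -- c`.
  obtain ⟨c, hc, d, hd, rfl⟩ := cs.exists_mul_eq_minReps J b
  have hcK : c ∈ cs.parabolic K := by
    simpa using mul_mem hb (inv_mem (parabolic_mono hJK hd))
  have hxc := (mul_mem_minReps_iff hJK hx hcK).2 hc
  rw [← mul_assoc] at hbw hmax
  refine ⟨x * c, (mul_mem_cosetInterval_iff hJK hx).2 ⟨hcK, hc, ?_⟩, fun y hy => ?_⟩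
  · exact (bruhatLE_mul_of_mem_minReps hxc hd).trans hbw
  · obtain ⟨a, rfl⟩ := exists_of_mem_cosetInterval hy
    have ha := (mul_mem_cosetInterval_iff hJK hx).1 hy
    exact (hmax a ha.1 ha.2.2).le_of_le_mul ((mul_mem_minReps_iff hJK hx ha.1).2 ha.2.1) hd

/-! ### The shift and the structure of a slice -/

theorem isMaximalIn_iff_of_greatest {A : Set W} {q p : W} (hq : q ∈ A)
    (hmax : ∀ y ∈ A, cs.BruhatLE y q) : cs.IsMaximalIn A p ↔ p = q := by
  constructor
  · rintro ⟨hp, h⟩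
    exact (h q hq (hmax p hp)).symm
  · rintro rfl
    exact ⟨hq, fun y hy h => (hmax y hy).antisymm h⟩

theorem mul_maxShift_eq {w x q : W} (hq : q ∈ cs.cosetInterval J K w x)
    (hmax : ∀ y ∈ cs.cosetInterval J K w x, cs.BruhatLE y q) :
    x * cs.maxShift J K w x = q := by
  rw [maxShift, mul_inv_cancel_left]
  refine (isMaximalIn_iff_of_greatest hq hmax).1 
    (Classical.epsilon_spec (p := cs.IsMaximalIn (cs.cosetInterval J K w x)) ⟨q, ?_⟩)
  exact (isMaximalIn_iff_of_greatest hq hmax).2 rfl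

theorem mul_maxShift_mem_cosetInterval (hJK : J ⊆ K) {x w : W} (hx : x ∈ cs.minReps K)
    (hxw : cs.BruhatLE x w) : x * cs.maxShift J K w x ∈ cs.cosetInterval J K w x := by
  obtain ⟨q, hq, hmax⟩ := exists_greatest_cosetInterval hJK hx hxw
  rwa [mul_maxShift_eq hq hmax]

theorem bruhatLE_mul_maxShift (hJK : J ⊆ K) {x w y : W} (hx : x ∈ cs.minReps K)
    (hxw : cs.BruhatLE x w) (hy : y ∈ cs.cosetInterval J K w x) :
    cs.BruhatLE y (x * cs.maxShift J K w x) := by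
  obtain ⟨q, hq, hmax⟩ := exists_greatest_cosetInterval hJK hx hxw
  rw [mul_maxShift_eq hq hmax]
  exact hmax y hy

theorem maxShift_mem_parabolic (hJK : J ⊆ K) {x w : W} (hx : x ∈ cs.minReps K)
    (hxw : cs.BruhatLE x w) : cs.maxShift J K w x ∈ cs.parabolic K :=
  ((mul_mem_cosetInterval_iff hJK hx).1 (mul_maxShift_mem_cosetInterval hJK hx hxw)).1

theorem mul_mem_cosetInterval_iff_mem_relInterval (hJK : J ⊆ K) {w x a : W}
    (hx : x ∈ cs.minReps K) (hxw : cs.BruhatLE x w) :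
    x * a ∈ cs.cosetInterval J K w x ↔ a ∈ cs.relInterval J (cs.maxShift J K w x) := by
  have hm := mul_maxShift_mem_cosetInterval hJK hx hxw
  have hm' := (mul_mem_cosetInterval_iff hJK hx).1 hm
  constructor
  · intro h
    have ha := (mul_mem_cosetInterval_iff hJK hx).1 h
    exact ⟨(mul_bruhatLE_mul_iff hx ha.1 hm'.1).1 (bruhatLE_mul_maxShift hJK hx hxw h), ha.2.1⟩
  · rintro ⟨h, ha⟩
    have haK := BruhatLE.mem_parabolic h hm'.1
    exact (mul_mem_cosetInterval_iff hJK hx).2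
      ⟨haK, ha, ((mul_bruhatLE_mul_iff hx haK hm'.1).2 h).trans hm'.2.2⟩

variable (cs J) in
theorem isGradedByLength_relInterval (m : W) : cs.IsGradedByLength (cs.relInterval J m) := by
  refine ⟨fun y _ z _ h => h.length_lt, fun y hy z hz h hcov => ?_⟩
  obtain ⟨a, ha, hya, haz, hl⟩ := exists_bruhatLT_length_add_one hy.2 hz.2 h
  by_cases he : y = a
  · rw [hl, he]
  · exact absurd ⟨⟨hya, he⟩, haz⟩ (hcov a ⟨haz.1.trans hz.1, ha⟩)

theorem bijOn_cosetInterval (hJK : J ⊆ K) {w x : W} (hx : x ∈ cs.minReps K)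
    (hxw : cs.BruhatLE x w) :
    Set.BijOn (fun y => x⁻¹ * y) (cs.cosetInterval J K w x)
      (cs.relInterval J (cs.maxShift J K w x)) := by
  refine ⟨fun y hy => ?_, fun y _ z _ h => mul_left_cancel h, fun a ha => ?_⟩
  · refine (mul_mem_cosetInterval_iff_mem_relInterval hJK hx hxw).1 ?_
    rwa [mul_inv_cancel_left]
  · exact ⟨x * a, (mul_mem_cosetInterval_iff_mem_relInterval hJK hx hxw).2 ha, by simp⟩

theorem bruhatLE_iff_of_mem_cosetInterval (hJK : J ⊆ K) {w x y z : W} (hx : x ∈ cs.minReps K)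
    (hy : y ∈ cs.cosetInterval J K w x) (hz : z ∈ cs.cosetInterval J K w x) :
    cs.BruhatLE y z ↔ cs.BruhatLE (x⁻¹ * y) (x⁻¹ * z) := by
  obtain ⟨a, rfl⟩ := exists_of_mem_cosetInterval hy
  obtain ⟨b, rfl⟩ := exists_of_mem_cosetInterval hz
  rw [inv_mul_cancel_left, inv_mul_cancel_left]
  exact mul_bruhatLE_mul_iff hx ((mul_mem_cosetInterval_iff hJK hx).1 hy).1
    ((mul_mem_cosetInterval_iff hJK hx).1 hz).1

theorem length_of_mem_cosetInterval (hJK : J ⊆ K) {w x y : W} (hx : x ∈ cs.minReps K)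
    (hy : y ∈ cs.cosetInterval J K w x) :
    cs.length y = cs.length x + cs.length (x⁻¹ * y) := by
  obtain ⟨a, rfl⟩ := exists_of_mem_cosetInterval hy
  rw [inv_mul_cancel_left]
  exact length_mul_of_mem_minReps hx ((mul_mem_cosetInterval_iff hJK hx).1 hy).1

theorem isGradedByLength_cosetInterval (hJK : J ⊆ K) {w x : W} (hx : x ∈ cs.minReps K)
    (hxw : cs.BruhatLE x w) : cs.IsGradedByLength (cs.cosetInterval J K w x) := by
  have hiff : ∀ y ∈ cs.cosetInterval J K w x, ∀ z ∈ cs.cosetInterval J K w x,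
      (cs.BruhatLT y z ↔ cs.BruhatLT (x⁻¹ * y) (x⁻¹ * z)) := fun y hy z hz =>
    and_congr (bruhatLE_iff_of_mem_cosetInterval hJK hx hy hz) (by simp)
  refine ⟨fun y _ z _ h => h.length_lt, fun y hy z hz h hcov => ?_⟩
  have hbij := bijOn_cosetInterval hJK hx hxw
  have := (cs.isGradedByLength_relInterval J (cs.maxShift J K w x)).2 _ (hbij.mapsTo hy) _
    (hbij.mapsTo hz) ((hiff y hy z hz).1 h) fun a ha hlt => by
      obtain ⟨c, hc, rfl⟩ := hbij.surjOn ha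
      exact hcov c hc ⟨(hiff y hy c hc).2 hlt.1, (hiff c hc z hz).2 hlt.2⟩
  rw [length_of_mem_cosetInterval hJK hx hy, length_of_mem_cosetInterval hJK hx hz, this,
    add_assoc]

/-- The slice over `v` contains `w = v u` itself, which bounds everything in it. -/
theorem maxShift_eq_of_isParabolicDecomposition (hJK : J ⊆ K) {w v u : W}
    (hw : w ∈ cs.minReps J) (h : cs.IsParabolicDecomposition K w v u) :
    cs.maxShift J K w v = u := by
  obtain ⟨hv, hu, rfl, -⟩ := h
  refine mul_left_cancel (a := v) (mul_maxShift_eq ?_ fun y hy => hy.1.1)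
  exact (mul_mem_cosetInterval_iff hJK hv).2
    ⟨hu, (mul_mem_minReps_iff hJK hv hu).1 hw, BruhatLE.refl _⟩

theorem maxShift_antitone (hJK : J ⊆ K) {w x x' : W} (hx : x ∈ cs.minReps K)
    (hx' : x' ∈ cs.minReps K) (h : cs.BruhatLE x x') (hxw : cs.BruhatLE x' w) :
    cs.BruhatLE (cs.maxShift J K w x') (cs.maxShift J K w x) := by
  have hm := (mul_mem_cosetInterval_iff hJK hx').1 (mul_maxShift_mem_cosetInterval hJK hx' hxw)
  rw [← mul_bruhatLE_mul_iff hx hm.1 (maxShift_mem_parabolic hJK hx (h.trans hxw))]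
  exact bruhatLE_mul_maxShift hJK hx (h.trans hxw) ((mul_mem_cosetInterval_iff hJK hx).2
    ⟨hm.1, hm.2.1, (mul_bruhatLE_mul_of_mem_minReps hx' hm.1 h).trans hm.2.2⟩)

/-! ### Poincaré polynomials -/

variable (cs J) in
theorem relInterval_finite (w : W) : (cs.relInterval J w).Finite :=
  (cs.lowerInterval_finite w).subset Set.inter_subset_left

variable (cs) in
theorem poincare_eq_finsum (hJK : J ⊆ K) (w : W) :
    cs.poincare J w =
      ∑ᶠ x ∈ cs.relInterval K w,
        (X : ℤ[X]) ^ cs.length x * cs.poincare J (cs.maxShift J K w x) := by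
  have hunion : cs.relInterval J w = ⋃ x ∈ cs.relInterval K w, cs.cosetInterval J K w x := by
    ext y
    simp only [Set.mem_iUnion, exists_prop]
    constructor
    · intro hy
      obtain ⟨x, hx, a, ha, rfl⟩ := cs.exists_mul_eq_minReps K y
      exact ⟨x, ⟨(bruhatLE_mul_of_mem_minReps hx ha).trans hy.1, hx⟩,
        (mul_mem_cosetInterval_iff hJK hx).2 ⟨ha, (mul_mem_minReps_iff hJK hx ha).1 hy.2, hy.1⟩⟩
    · rintro ⟨x, -, hy⟩
      exact hy.1
  have hdisj : (cs.relInterval K w).PairwiseDisjoint fun x => cs.cosetInterval J K w x := by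
    intro x hx x' hx' hne
    refine Set.disjoint_left.2 ?_
    rintro y ⟨-, a, ha, rfl⟩ ⟨-, b, hb, he⟩
    exact hne (eq_of_mul_eq_mul_minReps hx.2 hx'.2 ha.2 hb.2 he.symm).1
  rw [poincare, hunion, finsum_mem_biUnion hdisj (cs.relInterval_finite K w)
    fun x _ => (cs.relInterval_finite J w).subset Set.inter_subset_left]
  refine finsum_mem_congr rfl fun x hx => ?_
  rw [poincare, mul_finsum_mem]
  refine finsum_mem_eq_of_bijOn _ (bijOn_cosetInterval hJK hx.2 hx.1) fun y hy => ?_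
  rw [length_of_mem_cosetInterval hJK hx.2 hy, pow_add]

end CoxeterSystem

theorem proposition2p5 {B W : Type*} [Group W] {M : CoxeterMatrix B}
    (cs : CoxeterSystem M W) (J K : Set B) (hJK : J ⊆ K)
    (w : W) (hw : w ∈ cs.minReps J) :
    -- the objects in the statement are well defined:
    -- lower Bruhat intervals are finite,
    (∀ z : W, (cs.lowerInterval z).Finite) ∧
    -- the parabolic decomposition `w = v u` exists and is unique,
    (∃! p : W × W, cs.IsParabolicDecomposition K w p.1 p.2) ∧
    -- `q = x m(w, x)` is the unique maximal element, and even the greatest element,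
    -- of `[e, w]^J ∩ x W^J_K`
    (∀ x ∈ cs.minReps K, cs.BruhatLE x w →
      (∀ q : W, cs.IsMaximalIn (cs.cosetInterval J K w x) q ↔ q = x * cs.maxShift J K w x) ∧
      (∀ y ∈ cs.cosetInterval J K w x, cs.BruhatLE y (x * cs.maxShift J K w x))) ∧
    -- (1) `y ↦ x⁻¹ y` is an isomorphism of graded posets
    (∀ x ∈ cs.minReps K, cs.BruhatLE x w →
      cs.IsGradedByLength (cs.cosetInterval J K w x) ∧
      cs.IsGradedByLength (cs.relInterval J (cs.maxShift J K w x)) ∧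
      Set.BijOn (fun y => x⁻¹ * y) (cs.cosetInterval J K w x)
        (cs.relInterval J (cs.maxShift J K w x)) ∧
      (∀ y ∈ cs.cosetInterval J K w x, ∀ z ∈ cs.cosetInterval J K w x,
        (cs.BruhatLE y z ↔ cs.BruhatLE (x⁻¹ * y) (x⁻¹ * z))) ∧
      (∀ y ∈ cs.cosetInterval J K w x,
        cs.length y = cs.length x + cs.length (x⁻¹ * y))) ∧
    -- (5), first formula
    cs.poincare J w =
      ∑ᶠ x ∈ cs.relInterval K w,
        (X : ℤ[X]) ^ cs.length x * cs.poincare J (cs.maxShift J K w x) ∧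
    (∀ v u : W, cs.IsParabolicDecomposition K w v u →
      -- (2)
      cs.maxShift J K w v = u ∧
      -- (3)
      (∀ x ∈ cs.minReps K, ∀ x' ∈ cs.minReps K, cs.BruhatLT x x' → cs.BruhatLE x' v →
        cs.BruhatLE (cs.maxShift J K w x') (cs.maxShift J K w x)) ∧
      -- (4)
      (∀ x ∈ cs.minReps K, cs.BruhatLE x v →
        cs.BruhatLE (cs.maxShift J K w v) (cs.maxShift J K w x) ∧
        cs.BruhatLE (cs.maxShift J K w x) (cs.maxShift J K w 1)) ∧
      -- (5), factorization
      (cs.maxShift J K w v = cs.maxShift J K w 1 →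
        cs.poincare J w = cs.poincare K v * cs.poincare J u)) := by
  open CoxeterSystem in
  refine ⟨cs.lowerInterval_finite, cs.existsUnique_isParabolicDecomposition K w,
    fun x hx hxw => ⟨fun q => isMaximalIn_iff_of_greatest
      (mul_maxShift_mem_cosetInterval hJK hx hxw) fun y => bruhatLE_mul_maxShift hJK hx hxw,
      fun y => bruhatLE_mul_maxShift hJK hx hxw⟩,
    fun x hx hxw => ⟨isGradedByLength_cosetInterval hJK hx hxw,
      cs.isGradedByLength_relInterval J _, bijOn_cosetInterval hJK hx hxw,
      fun y hy z hz => bruhatLE_iff_of_mem_cosetInterval hJK hx hy hz,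
      fun y hy => length_of_mem_cosetInterval hJK hx hy⟩,
    cs.poincare_eq_finsum hJK w, fun v u hvu => ?_⟩
  have hu := CoxeterSystem.maxShift_eq_of_isParabolicDecomposition hJK hw hvu
  obtain ⟨hv, huK, hwvu, -⟩ := hvu
  have hvw : cs.BruhatLE v w := hwvu ▸ CoxeterSystem.bruhatLE_mul_of_mem_minReps hv huK
  have h4 : ∀ x ∈ cs.minReps K, cs.BruhatLE x v →
      cs.BruhatLE (cs.maxShift J K w v) (cs.maxShift J K w x) ∧
      cs.BruhatLE (cs.maxShift J K w x) (cs.maxShift J K w 1) := fun x hx hxv =>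
    ⟨CoxeterSystem.maxShift_antitone hJK hx hv hxv hvw,
      CoxeterSystem.maxShift_antitone hJK CoxeterSystem.one_mem_minReps hx (cs.one_bruhatLE x)
        (hxv.trans hvw)⟩
  refine ⟨hu, fun x hx x' hx' h hv' =>
    CoxeterSystem.maxShift_antitone hJK hx hx' h.1 (hv'.trans hvw), h4, fun he => ?_⟩
  -- Projection to `W^K` sends `w` to `v`, so both bound the same elements of `W^K`.
  have hrel : cs.relInterval K w = cs.relInterval K v := by
    ext x
    refine and_congr_left fun hx => ⟨fun h => ?_, fun h => CoxeterSystem.BruhatLE.trans h hvw⟩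
    exact CoxeterSystem.BruhatLE.le_of_le_mul hx huK (hwvu ▸ h)
  rw [cs.poincare_eq_finsum hJK w, hrel, CoxeterSystem.poincare,
    finsum_mem_mul]
  refine finsum_mem_congr rfl fun x hx => ?_
  have hx4 := h4 x hx.2 hx.1
  -- The two bounds on the shift at `x` now coincide, forcing it to be `u`.
  rw [← he, hu] at hx4
  rw [hx4.2.antisymm hx4.1]
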